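/- All graphs are finite, simple and undirected. For a positive integer $k$, the $k$-th power $G^k$ of a graph $G$ has the same vertex set as $G$, and two distinct vertices are adjacent in $G^k$ if and only if their distance in $G$ is at most $k$. The clique-width $\mathrm{cw}(G)$ of a graph $G$ is the minimum number of different labels needed to construct a vertex-labeled graph isomorphic to $G$ using the following four operations: (i) creation of a new vertex with label $i$; (ii) disjoint union of two labeled graphs; (iii) joining by an edge each vertex with label $i$ to each vertex with label $j$, for some $i \neq j$; (iv) relabeling each vertex with label $i$ with label $j$. (The graph without vertices is given clique-width $0$.) A class $\mathcal{G}$ of graphs closed under isomorphism is of power-bounded clique-width if there exists a positive integer $k$ such that $\sup\{\mathrm{cw}(G^k) : G \in \mathcal{G}\} < \infty$. A graph $G$ is $H$-free if no induced subgraph of $G$ is isomorphic to $H$. **Theorem.** For every graph $H$, the class of $H$-free graphs is of power-bounded clique-width if and only if $H$ is a disjoint union of paths (each with at least one vertex; the graph without vertices counts as the union of no paths). -/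

import Mathlib

/-! ### Graph powers and disjoint unions -/

namespace SimpleGraph

/-- The `k`-th power of `G`: two distinct vertices are adjacent when their distance in `G` is
at most `k` (`edist` is infinite between different components). -/
def power {V : Type*} (G : SimpleGraph V) (k : ℕ) : SimpleGraph V where
  Adj u v := u ≠ v ∧ G.edist u v ≤ (k : ℕ∞)
  symm := ⟨fun _ _ h => ⟨h.1.symm, by rw [edist_comm]; exact h.2⟩⟩
  loopless := ⟨fun _ h => h.1 rfl⟩

/-- The disjoint union of a family of graphs. -/
def disjointUnion {ι : Type*} {V : ι → Type*} (G : ∀ i, SimpleGraph (V i)) :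
    SimpleGraph (Σ i, V i) where
  Adj x y := ∃ (i : ι) (a b : V i), (G i).Adj a b ∧ x = ⟨i, a⟩ ∧ y = ⟨i, b⟩
  symm := ⟨fun _ _ ⟨i, a, b, h, hx, hy⟩ => ⟨i, b, a, h.symm, hy, hx⟩⟩
  loopless := ⟨by
    rintro x ⟨i, a, b, h, rfl, hb⟩
    cases hb
    exact h.ne rfl⟩

/-- `H` is isomorphic to a disjoint union of finitely many paths, each with at least one vertex
(`pathGraph n` is the path on `n` vertices). -/
def IsDisjointUnionOfPaths {U : Type*} (H : SimpleGraph U) : Prop :=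
  ∃ (m : ℕ) (n : Fin m → ℕ), (∀ i, 1 ≤ n i) ∧
    Nonempty (H ≃g disjointUnion fun i => pathGraph (n i))

end SimpleGraph

/-! ### Clique-width -/

/-- Expressions over the four clique-width operations, using labels from `Fin k`. -/
inductive CliqueExpr (k : ℕ) : Type
  /-- creation of a new vertex with label `i` -/
  | vertex (i : Fin k) : CliqueExpr k
  /-- disjoint union of two labelled graphs -/
  | union (a b : CliqueExpr k) : CliqueExpr k
  /-- joining by an edge each vertex with label `i` to each vertex with label `j ≠ i` -/
  | join (i j : Fin k) (hij : i ≠ j) (a : CliqueExpr k) : CliqueExpr k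
  /-- relabelling each vertex with label `i` with label `j` -/
  | relabel (i j : Fin k) (a : CliqueExpr k) : CliqueExpr k

namespace CliqueExpr

/-- The vertex set of the labelled graph built by an expression. -/
def Vert {k : ℕ} : CliqueExpr k → Type
  | vertex _ => Unit
  | union a b => a.Vert ⊕ b.Vert
  | join _ _ _ a => a.Vert
  | relabel _ _ a => a.Vert

/-- The labelling of the labelled graph built by an expression. -/
def label {k : ℕ} : (e : CliqueExpr k) → e.Vert → Fin k
  | vertex i => fun _ => i
  | union a b => Sum.elim a.label b.label
  | join _ _ _ a => a.label
  | relabel i j a => fun v => if a.label v = i then j else a.label v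

/-- The graph underlying the labelled graph built by an expression. -/
def graph {k : ℕ} : (e : CliqueExpr k) → SimpleGraph e.Vert
  | vertex _ => (⊥ : SimpleGraph Unit)
  | union a b => a.graph.sum b.graph
  | join i j _ a => a.graph ⊔ SimpleGraph.fromRel fun u v => a.label u = i ∧ a.label v = j
  | relabel _ _ a => a.graph

end CliqueExpr

/-- The clique-width of `G`: the least number of labels with which a labelled graph isomorphic
to `G` can be built. The graph without vertices, which no expression builds, needs no labels. -/
noncomputable def SimpleGraph.cliqueWidth {V : Type*} (G : SimpleGraph V) : ℕ∞ :=
  ⨅ (k : ℕ) (_ : IsEmpty V ∨ ∃ e : CliqueExpr k, Nonempty (e.graph ≃g G)), (k : ℕ∞)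

/-! ### Classes of finite graphs -/

/-- A class of finite simple graphs, closed under isomorphism. -/
structure GraphClass where
  /-- membership of a finite graph in the class -/
  Mem : ∀ (V : Type) [Finite V], SimpleGraph V → Prop
  /-- closure under isomorphism -/
  mem_of_iso : ∀ {V W : Type} [Finite V] [Finite W] {G : SimpleGraph V} {K : SimpleGraph W},
    Nonempty (G ≃g K) → Mem V G → Mem W K

namespace GraphClass

/-- The class of all `H`-free graphs: no induced subgraph is isomorphic to `H`. -/
def free {U : Type*} (H : SimpleGraph U) : GraphClass where
  Mem V _ G := ¬ H.IsIndContained G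
  mem_of_iso := by
    rintro V W _ _ G K ⟨f⟩ hG ⟨g⟩
    exact hG ⟨f.symm.toEmbedding.comp g⟩

/-- The class of all graphs (isomorphic to) `k`-th powers of graphs in a class. -/
def power (𝒢 : GraphClass) (k : ℕ) : GraphClass where
  Mem W _ K := ∃ (V : Type) (_ : Finite V) (G : SimpleGraph V),
    𝒢.Mem V G ∧ Nonempty (G.power k ≃g K)
  mem_of_iso := by
    rintro V W _ _ G K ⟨f⟩ ⟨X, hX, L, hL, ⟨g⟩⟩
    exact ⟨X, hX, L, hL, ⟨g.trans f⟩⟩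

/-- The clique-width of a graph class: the supremum of the clique-widths of its members. -/
noncomputable def cliqueWidth (𝒢 : GraphClass) : ℕ∞ :=
  ⨆ (V : Type) (_ : Finite V) (G : SimpleGraph V) (_ : 𝒢.Mem V G), G.cliqueWidth

/-- A graph class is of bounded clique-width. -/
def IsBoundedCliqueWidth (𝒢 : GraphClass) : Prop := 𝒢.cliqueWidth < ⊤

/-- A graph class is of power-bounded clique-width: for some positive integer `k`, its `k`-th
power is of bounded clique-width. -/
def IsPowerBoundedCliqueWidth (𝒢 : GraphClass) : Prop :=
  ∃ k : ℕ, 1 ≤ k ∧ (𝒢.power k).IsBoundedCliqueWidth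

end GraphClass

/-! ### Classes excluding a disjoint union of paths -/

namespace SimpleGraph

/-! If `H` is a disjoint union of paths, it is induced in one long path, so an `H`-free graph has no
long induced path. Shortest paths are induced, so its components have bounded diameter, and a fixed
power turns each component into a clique. Disjoint unions of cliques need only two labels
(`cliqueWidth_le_two`).

Conversely, an expression for a graph of small clique-width yields a balanced vertex set `A` whose
vertices have few adjacency types towards the complement. With bounded degree, few vertices of `A`
have neighbours outside (`exists_balanced_of_cliqueWidth_le`). A graph `G` between a subdivided grid
and the king's graph defeats every exponent `k`: `G.power k` has bounded degree but still contains
the subdivided grid, in which a set with small boundary contains almost all or almost none of the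
branch points (`ncard_grid_le`).

If `H` has a cycle, subdivided grids with long enough subdivisions are `H`-free. If `H` is acyclic
with a vertex of degree at least three, it contains an induced claw, and the claw-free block graphs
are `H`-free. Hence `H` is acyclic of maximum degree at most two, and a longest path in each
component spans it. -/

theorem disjointUnion_adj_mk {ι : Type*} {V : ι → Type*} (G : ∀ i, SimpleGraph (V i)) {i : ι}
    {a b : V i} : (disjointUnion G).Adj ⟨i, a⟩ ⟨i, b⟩ ↔ (G i).Adj a b := by
  constructor
  · rintro ⟨j, c, d, h, hx, hy⟩
    cases hx
    cases hy
    exact h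
  · exact fun h => ⟨i, a, b, h, rfl, rfl⟩

theorem disjointUnion_adj_fst {ι : Type*} {V : ι → Type*} {G : ∀ i, SimpleGraph (V i)}
    {x y : Σ i, V i} (h : (disjointUnion G).Adj x y) : x.1 = y.1 := by
  obtain ⟨i, a, b, -, rfl, rfl⟩ := h
  rfl

/-- A disjoint union of paths is an induced subgraph of a sufficiently long path. -/
theorem disjointUnion_pathGraph_isIndContained {m : ℕ} (n : Fin m → ℕ) :
    (disjointUnion fun i => pathGraph (n i)).IsIndContained (pathGraph (∑ i, (n i + 1))) := by
  set N := ∑ i, (n i + 1)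
  -- Each path takes `n j + 1` places, the last left empty as a gap that separates it from the next
  -- path.
  let off : Fin m → ℕ := fun i => ∑ j ∈ Finset.Iio i, (n j + 1)
  have step : ∀ i, off i + (n i + 1) = ∑ j ∈ Finset.Iic i, (n j + 1) := fun i => by
    rw [← Finset.Iio_insert i, Finset.sum_insert (by simp), add_comm]
  have hlt : ∀ i j, i < j → off i + (n i + 1) ≤ off j := fun i j hij => by
    rw [step]
    exact Finset.sum_le_sum_of_subset fun x hx => by
      simp only [Finset.mem_Iic, Finset.mem_Iio] at *
      exact lt_of_le_of_lt hx hij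
  have hN : ∀ i, off i + (n i + 1) ≤ N := fun i => by
    rw [step]
    exact Finset.sum_le_sum_of_subset (Finset.subset_univ _)
  have key : ∀ (i j : Fin m) (s : Fin (n i)) (t : Fin (n j)),
      off i + s.val ≤ off j + t.val + 1 → off j + t.val ≤ off i + s.val + 1 → i = j := by
    intro i j s t h1 h2
    have hs := s.2
    have ht := t.2
    rcases lt_trichotomy i j with h | h | h
    · have := hlt i j h
      omega
    · exact h
    · have := hlt j i h
      omega
  refine ⟨⟨⟨fun x => ⟨off x.1 + x.2.val, by have := hN x.1; have := x.2.2; omega⟩, ?_⟩, ?_⟩⟩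
  · rintro ⟨i, s⟩ ⟨j, t⟩ h
    simp only [Fin.mk.injEq] at h
    obtain rfl := key i j s t (by omega) (by omega)
    obtain rfl : s = t := Fin.ext (by omega)
    rfl
  · rintro ⟨i, s⟩ ⟨j, t⟩
    refine pathGraph_adj.trans ?_
    change off i + s.val + 1 = off j + t.val ∨ off j + t.val + 1 = off i + s.val ↔ _
    constructor
    · intro h
      obtain rfl := key i j s t (by omega) (by omega)
      rw [disjointUnion_adj_mk, pathGraph_adj]
      omega
    · intro h
      obtain rfl : i = j := disjointUnion_adj_fst h
      rw [disjointUnion_adj_mk, pathGraph_adj] at h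
      omega

/-- Two vertices at finite distance at least `N` are joined by an induced path, so that the path
on `N` vertices is an induced subgraph. -/
theorem Reachable.pathGraph_isIndContained {V : Type*} {G : SimpleGraph V} {u v : V}
    (h : G.Reachable u v) {N : ℕ} (hN : N ≤ G.dist u v) : (pathGraph N).IsIndContained G := by
  obtain ⟨p, hp, hl⟩ := h.exists_path_of_dist
  -- A chord skipping vertices would shortcut `p` below the distance between its ends.
  have hle : ∀ i j : ℕ, i ≤ j → j ≤ p.length → G.Adj (p.getVert i) (p.getVert j) → j ≤ i + 1 := by
    intro i j hij hj hadj
    have h1 := G.dist_le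
      ((p.take i).append (Walk.cons hadj (p.drop j)))
    simp only [Walk.length_append, Walk.length_cons, Walk.take_length, Walk.drop_length] at h1
    omega
  refine ⟨⟨⟨fun i => p.getVert i, ?_⟩, ?_⟩⟩
  · intro i j hij
    have hi := i.2
    have hj := j.2
    exact Fin.ext (hp.getVert_injOn (by simp; omega) (by simp; omega) hij)
  · intro i j
    have hi := i.2
    have hj := j.2
    rw [pathGraph_adj]
    change G.Adj (p.getVert i) (p.getVert j) ↔ _
    constructor
    · intro hadj
      have hne : i.val ≠ j.val := fun he => hadj.ne (by rw [he])
      rcases le_total i.val j.val with hij | hij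
      · have := hle i j hij (by omega) hadj
        omega
      · have := hle j i hij (by omega) hadj.symm
        omega
    · rintro (h | h)
      · rw [← h]
        exact p.adj_getVert_succ (by omega)
      · rw [← h]
        exact (p.adj_getVert_succ (by omega)).symm

/-- A power of a graph without long induced paths joins all vertices of each component. -/
theorem power_adj_iff_reachable {V : Type*} {G : SimpleGraph V} {N : ℕ}
    (h : ¬ (pathGraph N).IsIndContained G) {u v : V} :
    (G.power (N + 1)).Adj u v ↔ u ≠ v ∧ G.Reachable u v := by
  refine and_congr_right fun _ => ⟨fun huv => ?_, fun huv => ?_⟩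
  · exact reachable_of_edist_ne_top (ne_top_of_le_ne_top (ENat.natCast_ne_top _) huv)
  · by_contra hlt
    refine h (huv.pathGraph_isIndContained ?_)
    rw [← huv.coe_dist_eq_edist, Nat.cast_le] at hlt
    omega

/-! ### Clique-width of disjoint unions of complete graphs -/

/-- The vertices in `S` induce a subgraph that can be built with labels from `Fin (c + 1)` so that
all vertices finally have label `0`. -/
def CliqueBuildable {V : Type*} (K : SimpleGraph V) (c : ℕ) (S : Set V) : Prop :=
  ∃ (e : CliqueExpr (c + 1)) (φ : e.graph ↪g K), Set.range φ = S ∧ ∀ x, e.label x = 0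

theorem CliqueBuildable.singleton {V : Type*} (K : SimpleGraph V) (c : ℕ) (v : V) :
    K.CliqueBuildable c {v} := by
  refine ⟨.vertex 0, ⟨⟨fun _ => v, fun x y _ => Subsingleton.elim (α := Unit) x y⟩, ?_⟩, ?_,
    fun _ => rfl⟩
  · exact iff_of_false (K.loopless.irrefl v) id
  · exact Set.range_const (ι := Unit)

/-- The map out of a union of expressions given by two maps with disjoint ranges between which
there are no edges. -/
def unionEmbedding {V : Type*} {K : SimpleGraph V} {k : ℕ} {a b : CliqueExpr k}
    (φ : a.graph ↪g K) (ψ : b.graph ↪g K)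
    (hd : ∀ x y, φ x ≠ ψ y ∧ ¬ K.Adj (φ x) (ψ y)) : (CliqueExpr.union a b).graph ↪g K where
  toFun := Sum.elim φ ψ
  inj' := Function.Injective.sumElim φ.injective ψ.injective fun x y => (hd x y).1
  map_rel_iff' := by
    rintro (x | x) (y | y)
    · exact φ.map_rel_iff.trans (by simp [CliqueExpr.graph])
    · exact iff_of_false (hd x y).2 (by simp [CliqueExpr.graph])
    · exact iff_of_false (fun h => (hd y x).2 h.symm) (by simp [CliqueExpr.graph])
    · exact ψ.map_rel_iff.trans (by simp [CliqueExpr.graph])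

theorem CliqueBuildable.union {V : Type*} {K : SimpleGraph V} {c : ℕ} {S T : Set V}
    (hS : K.CliqueBuildable c S) (hT : K.CliqueBuildable c T)
    (h : ∀ x ∈ S, ∀ y ∈ T, x ≠ y ∧ ¬ K.Adj x y) : K.CliqueBuildable c (S ∪ T) := by
  obtain ⟨a, φ, rfl, hφ⟩ := hS
  obtain ⟨b, ψ, rfl, hψ⟩ := hT
  refine ⟨.union a b, unionEmbedding φ ψ fun x y => h _ ⟨x, rfl⟩ _ ⟨y, rfl⟩, ?_, ?_⟩
  · exact Set.Sum.elim_range φ ψ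
  · rintro (x | x)
    · exact hφ x
    · exact hψ x

/-- Label `1` is free, so it can mark the new vertex while it is joined to everything labelled `0`;
relabelling then frees it again. -/
theorem CliqueBuildable.insert {V : Type*} {K : SimpleGraph V} {S : Set V} {v : V}
    (hS : K.CliqueBuildable 1 S) (h : ∀ x ∈ S, K.Adj x v) :
    K.CliqueBuildable 1 (insert v S) := by
  obtain ⟨a, φ, rfl, hφ⟩ := hS
  let b : CliqueExpr 2 := .union a (.vertex 1)
  let f : b.Vert → V := Sum.elim φ fun _ => v
  refine ⟨.relabel 1 0 (.join 0 1 (by decide) b), ⟨⟨f, ?_⟩, ?_⟩, ?_, ?_⟩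
  · exact Function.Injective.sumElim φ.injective (fun x y _ => Subsingleton.elim (α := Unit) x y)
      fun x y => (h _ ⟨x, rfl⟩).ne
  · rintro (x | x) (y | y)
    · refine φ.map_rel_iff.trans ⟨.inl, ?_⟩
      rintro (hadj | ⟨-, ⟨-, h1⟩ | ⟨-, h1⟩⟩)
      · exact hadj
      · exact absurd ((hφ y).symm.trans h1) (by decide)
      · exact absurd ((hφ x).symm.trans h1) (by decide)
    · exact iff_of_true (h _ ⟨x, rfl⟩) (.inr ⟨Sum.inl_ne_inr, .inl ⟨hφ x, rfl⟩⟩)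
    · exact iff_of_true (h _ ⟨y, rfl⟩).symm (.inr ⟨Sum.inr_ne_inl, .inr ⟨hφ y, rfl⟩⟩)
    · obtain rfl : x = y := Subsingleton.elim (α := Unit) x y
      exact iff_of_false (K.loopless.irrefl v) (SimpleGraph.irrefl _)
  · ext w
    simp only [Set.mem_range, Set.mem_insert_iff]
    constructor
    · rintro ⟨x | x, rfl⟩
      · exact .inr ⟨x, rfl⟩
      · exact .inl rfl
    · rintro (rfl | ⟨x, rfl⟩)
      · exact ⟨.inr (), rfl⟩
      · exact ⟨.inl x, rfl⟩
  · rintro (x | x)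
    · simp [CliqueExpr.label, hφ, b]
    · simp [CliqueExpr.label, b]

theorem cliqueBuildable_of_isClique {V : Type*} {K : SimpleGraph V} {S : Finset V}
    (hne : S.Nonempty) (h : K.IsClique S) : K.CliqueBuildable 1 S := by
  classical
  induction hne using Finset.Nonempty.cons_induction with
  | singleton a => simpa only [Finset.coe_singleton] using CliqueBuildable.singleton K 1 a
  | cons a s ha hs ih =>
    rw [Finset.coe_cons] at h ⊢
    refine (ih (h.subset (Set.subset_insert _ _))).insert fun x hx => ?_
    exact h (Set.mem_insert_of_mem _ hx) (Set.mem_insert _ _) fun he => ha (he ▸ hx)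

theorem CliqueBuildable.cliqueWidth_le {V : Type*} {K : SimpleGraph V} {c : ℕ}
    (h : K.CliqueBuildable c Set.univ) : K.cliqueWidth ≤ (c + 1 : ℕ) := by
  obtain ⟨e, φ, hφ, -⟩ := h
  refine iInf₂_le (c + 1) (.inr ⟨e, ⟨⟨Equiv.ofBijective φ ⟨φ.injective, ?_⟩, φ.map_rel_iff⟩⟩⟩)
  exact Set.range_eq_univ.mp hφ

/-- Each class of `r` is a clique, built with two labels and left entirely with label `0`; distinct
classes are then combined by unions alone. -/
theorem cliqueWidth_le_two {V : Type*} [Finite V] {K : SimpleGraph V} (r : Setoid V)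
    (h : ∀ u v, K.Adj u v ↔ u ≠ v ∧ r u v) : K.cliqueWidth ≤ 2 := by
  classical
  have := Fintype.ofFinite V
  cases isEmpty_or_nonempty V with
  | inl hV => exact (iInf₂_le 0 (.inl hV)).trans (by simp)
  | inr hV =>
  have hclass : ∀ v, K.CliqueBuildable 1 {u | r u v} := fun v => by
    have := cliqueBuildable_of_isClique (K := K) (S := Finset.univ.filter fun u => r u v)
      ⟨v, by simp⟩ (by
        intro x hx y hy hxy
        simp only [Finset.coe_filter, Finset.mem_univ, true_and, Set.mem_ofPred_eq] at hx hy
        exact (h x y).2 ⟨hxy, r.trans hx (r.symm hy)⟩)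
    simpa using this
  have key : ∀ F : Finset V, F.Nonempty → K.CliqueBuildable 1 {u | ∃ v ∈ F, r u v} := by
    intro F hF
    induction hF using Finset.Nonempty.cons_induction with
    | singleton a => simpa only [Finset.mem_singleton, exists_eq_left] using hclass a
    | cons a s ha hs ih =>
      have hset : {u | ∃ v ∈ Finset.cons a s ha, r u v} = {u | r u a} ∪ {u | ∃ v ∈ s, r u v} := by
        ext u
        simp
      rw [hset]
      -- If `a` is related to an earlier vertex, its class has already been built.
      by_cases hmem : ∃ v ∈ s, r a v
      · obtain ⟨v, hv, hav⟩ := hmem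
        rwa [Set.union_eq_right.2]
        exact fun u hu => ⟨v, hv, r.trans hu hav⟩
      · refine (hclass a).union ih ?_
        rintro x hx y ⟨v, hv, hyv⟩
        have hxy : ¬ r x y := fun hxy =>
          hmem ⟨v, hv, r.trans (r.symm hx) (r.trans hxy hyv)⟩
        exact ⟨fun he => hxy (he ▸ r.refl x), fun hadj => hxy ((h x y).1 hadj).2⟩
  have := key Finset.univ Finset.univ_nonempty
  have huniv : {u | ∃ v ∈ Finset.univ, r u v} = Set.univ :=
    Set.eq_univ_of_forall fun u => ⟨u, Finset.mem_univ u, r.refl u⟩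
  rw [huniv] at this
  exact this.cliqueWidth_le

end SimpleGraph

theorem CliqueExpr.exists_iso_congr {k : ℕ} {V W : Type*} {G : SimpleGraph V}
    {K : SimpleGraph W} (f : G ≃g K) (h : IsEmpty V ∨ ∃ e : CliqueExpr k, Nonempty (e.graph ≃g G)) :
    IsEmpty W ∨ ∃ e : CliqueExpr k, Nonempty (e.graph ≃g K) :=
  h.imp (fun hV => ⟨fun w => hV.false (f.symm w)⟩) fun ⟨e, ⟨g⟩⟩ => ⟨e, ⟨g.trans f⟩⟩

theorem SimpleGraph.Iso.cliqueWidth_eq {V W : Type*} {G : SimpleGraph V} {K : SimpleGraph W}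
    (f : G ≃g K) : G.cliqueWidth = K.cliqueWidth := by
  unfold SimpleGraph.cliqueWidth
  exact iInf_congr fun k => iInf_congr_Prop
    ⟨CliqueExpr.exists_iso_congr f, CliqueExpr.exists_iso_congr f.symm⟩ fun _ => rfl

theorem GraphClass.isPowerBoundedCliqueWidth_free {U : Type*} {H : SimpleGraph U}
    (hH : H.IsDisjointUnionOfPaths) : (GraphClass.free H).IsPowerBoundedCliqueWidth := by
  obtain ⟨m, n, -, ⟨f⟩⟩ := hH
  have hN := SimpleGraph.disjointUnion_pathGraph_isIndContained n
  set N := ∑ i, (n i + 1)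
  -- For `m = 0` the sum `N` is `0`; the exponent `N + 1` is always positive.
  refine ⟨N + 1, by omega, lt_of_le_of_lt (b := 2) ?_ (ENat.natCast_lt_top 2)⟩
  refine iSup_le fun W => iSup_le fun _ => iSup_le fun K => iSup_le ?_
  rintro ⟨V, hV, G, hG, ⟨g⟩⟩
  rw [← g.cliqueWidth_eq]
  refine SimpleGraph.cliqueWidth_le_two G.reachableSetoid fun u v => ?_
  refine SimpleGraph.power_adj_iff_reachable fun hP => hG ?_
  exact SimpleGraph.IsIndContained.trans ⟨f.toEmbedding⟩ (hN.trans hP)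

/-! ### A lower bound for clique-width through balanced separations -/

/-- Every large vertex set `W` is split in a balanced way by some vertex set `A` whose vertices
have few adjacency types towards the complement of `A`. -/
theorem CliqueExpr.exists_balanced {k : ℕ} {m : ℕ} (hm : 1 ≤ m) (e : CliqueExpr k)
    (W : Set e.Vert) (hW : W.Finite) (hcard : m < W.ncard) :
    ∃ (A : Set e.Vert) (t : e.Vert → Fin k), m < (W ∩ A).ncard ∧ (W ∩ A).ncard ≤ 2 * m ∧
      ∀ u ∈ A, ∀ v ∈ A, t u = t v → e.label u = e.label v ∧
        ∀ w ∉ A, e.graph.Adj u w → e.graph.Adj v w := by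
  -- Equal types in `A` force equal labels, and joins see only labels, so operations above the
  -- chosen subexpression cannot distinguish such vertices from outside.
  induction e with
  | vertex i =>
    have : W.ncard ≤ 1 := (Set.ncard_le_one hW).2
      fun x _ y _ => Subsingleton.elim (α := Unit) x y
    omega
  | join i j hij a ih =>
    obtain ⟨A, t, h1, h2, h3⟩ := ih W hW hcard
    refine ⟨A, t, h1, h2, fun u hu v hv huv => ⟨(h3 u hu v hv huv).1, ?_⟩⟩
    have hl := (h3 u hu v hv huv).1
    rintro w hw (hadj | ⟨-, ⟨h4, h5⟩ | ⟨h4, h5⟩⟩)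
    · exact .inl ((h3 u hu v hv huv).2 w hw hadj)
    · exact .inr ⟨fun he => hw (he ▸ hv), .inl ⟨hl.symm.trans h4, h5⟩⟩
    · exact .inr ⟨fun he => hw (he ▸ hv), .inr ⟨h4, hl.symm.trans h5⟩⟩
  | relabel i j a ih =>
    obtain ⟨A, t, h1, h2, h3⟩ := ih W hW hcard
    refine ⟨A, t, h1, h2, fun u hu v hv huv => ⟨?_, (h3 u hu v hv huv).2⟩⟩
    change (if a.label u = i then j else a.label u) = if a.label v = i then j else a.label v
    rw [(h3 u hu v hv huv).1]
  | union a b iha ihb =>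
    -- Stop descending once at most `2 * m` points of `W` remain, with the current labels as types.
    -- Otherwise one side of the union holds more than `m` of them; the types chosen on the other
    -- side are irrelevant.
    by_cases hbig : W.ncard ≤ 2 * m
    · exact ⟨Set.univ, (union a b).label, by simpa using hcard, by simpa using hbig,
        fun u _ v _ h => ⟨h, fun w hw => (hw trivial).elim⟩⟩
    let f : a.Vert → a.Vert ⊕ b.Vert := Sum.inl
    let g : b.Vert → a.Vert ⊕ b.Vert := Sum.inr
    have hf : f.Injective := Sum.inl_injective
    have hg : g.Injective := Sum.inr_injective
    let W' : Set (a.Vert ⊕ b.Vert) := W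
    have hW' : W'.Finite := hW
    have hsplit : W' = f '' (f ⁻¹' W') ∪ g '' (g ⁻¹' W') := by
      ext (x | x) <;> simp [f, g]
    have hsum : W'.ncard ≤ (f ⁻¹' W').ncard + (g ⁻¹' W').ncard := by
      conv_lhs => rw [hsplit]
      refine (Set.ncard_union_le _ _).trans ?_
      rw [Set.ncard_image_of_injective _ hf, Set.ncard_image_of_injective _ hg]
    change ∃ (A : Set (a.Vert ⊕ b.Vert)) (t : a.Vert ⊕ b.Vert → Fin k), m < (W' ∩ A).ncard ∧
      (W' ∩ A).ncard ≤ 2 * m ∧ _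
    change ¬ W'.ncard ≤ 2 * m at hbig
    by_cases ha : m < (f ⁻¹' W').ncard
    · obtain ⟨A, t, h1, h2, h3⟩ := iha _ (hW'.preimage hf.injOn) ha
      have hWA : (W' ∩ f '' A).ncard = (f ⁻¹' W' ∩ A).ncard := by
        rw [Set.inter_comm, ← Set.image_inter_preimage, Set.ncard_image_of_injective _ hf,
          Set.inter_comm]
      refine ⟨f '' A, Sum.elim t b.label, hWA ▸ h1, hWA ▸ h2, ?_⟩
      rintro _ ⟨u, hu, rfl⟩ _ ⟨v, hv, rfl⟩ huv
      refine ⟨(h3 u hu v hv huv).1, ?_⟩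
      rintro (w | w) hw hadj
      · exact (h3 u hu v hv huv).2 w (fun hwA => hw ⟨w, hwA, rfl⟩) hadj
      · exact (Bool.false_ne_true hadj).elim
    · obtain ⟨A, t, h1, h2, h3⟩ := ihb _ (hW'.preimage hg.injOn) (by omega)
      have hWA : (W' ∩ g '' A).ncard = (g ⁻¹' W' ∩ A).ncard := by
        rw [Set.inter_comm, ← Set.image_inter_preimage, Set.ncard_image_of_injective _ hg,
          Set.inter_comm]
      refine ⟨g '' A, Sum.elim a.label t, hWA ▸ h1, hWA ▸ h2, ?_⟩
      rintro _ ⟨u, hu, rfl⟩ _ ⟨v, hv, rfl⟩ huv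
      refine ⟨(h3 u hu v hv huv).1, ?_⟩
      rintro (w | w) hw hadj
      · exact (Bool.false_ne_true hadj).elim
      · exact (h3 u hu v hv huv).2 w (fun hwA => hw ⟨w, hwA, rfl⟩) hadj

namespace SimpleGraph

theorem exists_cliqueExpr_of_cliqueWidth_le {V : Type*} [Nonempty V] {K : SimpleGraph V} {c : ℕ}
    (h : K.cliqueWidth ≤ c) : ∃ k ≤ c, ∃ e : CliqueExpr k, Nonempty (e.graph ≃g K) := by
  by_contra! hcon
  have : ((c + 1 : ℕ) : ℕ∞) ≤ K.cliqueWidth := by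
    refine le_iInf₂ fun k hk => ?_
    rcases hk with hV | ⟨e, ⟨f⟩⟩
    · exact (not_isEmpty_of_nonempty V hV).elim
    · rw [Nat.cast_le]
      by_contra hlt
      exact (hcon k (by omega) e).false f
  have := this.trans h
  rw [Nat.cast_le] at this
  omega

/-- A graph of clique-width at most `c` and maximum degree at most `D` has, for each large vertex
set `W`, a vertex set splitting `W` in a balanced way with at most `c * D` boundary vertices. -/
theorem exists_balanced_of_cliqueWidth_le {V : Type*} [Finite V] {K : SimpleGraph V} {c D : ℕ}
    (hK : K.cliqueWidth ≤ c) (hD : ∀ w, (K.neighborSet w).ncard ≤ D) (W : Set V) {m : ℕ}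
    (hm : 1 ≤ m) (hW : m < W.ncard) :
    ∃ A : Set V, m < (W ∩ A).ncard ∧ (W ∩ A).ncard ≤ 2 * m ∧
      {u ∈ A | ∃ w ∉ A, K.Adj u w}.ncard ≤ c * D := by
  classical
  have := Fintype.ofFinite V
  have hne : Nonempty V := by
    obtain ⟨v, -⟩ := (Set.ncard_pos (Set.toFinite W)).1 (by omega)
    exact ⟨v⟩
  obtain ⟨k, hk, e, ⟨f⟩⟩ := exists_cliqueExpr_of_cliqueWidth_le hK
  have hfin : Finite e.Vert := Finite.of_equiv V f.symm.toEquiv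
  have hcard : ∀ B : Set V, (f ⁻¹' B).ncard = B.ncard := fun B =>
    Set.ncard_preimage_of_injective_subset_range f.injective (by simp [f.surjective.range_eq])
  obtain ⟨A, t, h1, h2, h3⟩ := e.exists_balanced hm (f ⁻¹' W) (Set.toFinite _) (by rwa [hcard])
  have hpre : f ⁻¹' (W ∩ f '' A) = f ⁻¹' W ∩ A := by
    rw [Set.preimage_inter, Set.preimage_image_eq _ f.injective]
  refine ⟨f '' A, by rwa [← hcard, hpre], by rwa [← hcard, hpre], ?_⟩
  set B := {u ∈ f '' A | ∃ w ∉ f '' A, K.Adj u w}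
  have hmul : B.toFinset.card ≤ D * (Finset.univ : Finset (Fin k)).card := by
    -- If a boundary vertex of a given type has an outside neighbour `w`, all vertices of `A` of
    -- that type are neighbours of `w`, so there are at most `D` of them.
    refine Finset.card_le_mul_card_image_of_maps_to (f := fun u => t (f.symm u))
      (fun _ _ => Finset.mem_univ _) D fun l _ => ?_
    rcases Finset.eq_empty_or_nonempty {a ∈ B.toFinset | t (f.symm a) = l} with h0 | ⟨u, hu⟩
    · simp [h0]
    · simp only [Finset.mem_filter, Set.mem_toFinset] at hu
      obtain ⟨⟨⟨u, huA, rfl⟩, w, hw, hadj⟩, rfl⟩ := hu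
      rw [← Set.ncard_coe_finset]
      refine (Set.ncard_le_ncard ?_ (Set.toFinite _)).trans (hD w)
      intro v hv
      simp only [Finset.coe_filter, Set.mem_toFinset, Set.mem_ofPred_eq] at hv
      obtain ⟨⟨⟨v, hvA, rfl⟩, -⟩, hvt⟩ := hv
      simp only [RelIso.symm_apply_apply] at hvt
      have := (h3 u huA v hvA hvt.symm).2 (f.symm w) (fun hwA => hw ⟨_, hwA, by simp⟩)
        (by rw [← f.map_adj_iff]; simpa using hadj)
      rw [← f.map_adj_iff, RelIso.apply_symm_apply] at this
      exact this.symm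
  rw [Finset.card_univ, Fintype.card_fin] at hmul
  rw [Set.ncard_eq_toFinset_card']
  calc B.toFinset.card ≤ D * k := hmul
    _ ≤ c * D := by rw [mul_comm]; exact Nat.mul_le_mul_right _ hk

end SimpleGraph

/-! ### Separations of subdivided grids -/

namespace SimpleGraph

/-- The points of a square grid, with edges only along the horizontal and vertical lines whose
constant coordinate is a multiple of `r`: a subdivided grid, up to isolated vertices. -/
def subdividedGrid (r M : ℕ) : SimpleGraph (Fin M × Fin M) where
  Adj p q :=
    (p.2 = q.2 ∧ r ∣ p.2.val ∧ (p.1.val + 1 = q.1.val ∨ q.1.val + 1 = p.1.val)) ∨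
    (p.1 = q.1 ∧ r ∣ p.1.val ∧ (p.2.val + 1 = q.2.val ∨ q.2.val + 1 = p.2.val))
  symm := ⟨fun p q h => by
    rcases h with ⟨h1, h2, h3⟩ | ⟨h1, h2, h3⟩
    · exact .inl ⟨h1.symm, h1 ▸ h2, h3.symm⟩
    · exact .inr ⟨h1.symm, h1 ▸ h2, h3.symm⟩⟩
  loopless := ⟨fun p h => by
    rcases h with ⟨-, -, h3⟩ | ⟨-, -, h3⟩ <;> omega⟩

/-- All edges of a graph on the points of a square grid join points at most one step apart in each
coordinate. -/
def IsKingLike {M : ℕ} (G : SimpleGraph (Fin M × Fin M)) : Prop :=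
  ∀ p q, G.Adj p q → q.1.val ≤ p.1.val + 1 ∧ q.2.val ≤ p.2.val + 1

theorem subdividedGrid_isKingLike (r M : ℕ) : (subdividedGrid r M).IsKingLike := by
  rintro p q (⟨h1, -, h3⟩ | ⟨h1, -, h3⟩)
  · rw [h1]; omega
  · rw [h1]; omega

theorem Walk.le_add_length {V : Type*} {G : SimpleGraph V} {f : V → ℕ}
    (hf : ∀ u v, G.Adj u v → f v ≤ f u + 1) {u v : V} (p : G.Walk u v) :
    f v ≤ f u + p.length := by
  induction p with
  | nil => simp
  | cons h p ih =>
    have := hf _ _ h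
    rw [Walk.length_cons]
    omega

theorem le_add_of_edist_le {V : Type*} {G : SimpleGraph V} {f : V → ℕ}
    (hf : ∀ u v, G.Adj u v → f v ≤ f u + 1) {u v : V} {k : ℕ} (h : G.edist u v ≤ k) :
    f v ≤ f u + k := by
  obtain ⟨p, hp⟩ := exists_walk_of_edist_ne_top (ne_top_of_le_ne_top (ENat.natCast_ne_top k) h)
  rw [← hp, Nat.cast_le] at h
  exact (p.le_add_length hf).trans (by omega)

/-- Each edge changes a coordinate by at most one, so a ball of radius `k` fits in a square of side
`2 * k + 1`. -/
theorem IsKingLike.ncard_neighborSet_power_le {M : ℕ} {G : SimpleGraph (Fin M × Fin M)}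
    (hG : G.IsKingLike) (k : ℕ) (w : Fin M × Fin M) :
    ((G.power k).neighborSet w).ncard ≤ (2 * k + 1) ^ 2 := by
  let S : Finset (ℕ × ℕ) :=
    Finset.Icc (w.1.val - k) (w.1.val + k) ×ˢ Finset.Icc (w.2.val - k) (w.2.val + k)
  have hS : S.card ≤ (2 * k + 1) ^ 2 := by
    rw [Finset.card_product, Nat.card_Icc, Nat.card_Icc, sq]
    exact Nat.mul_le_mul (by omega) (by omega)
  refine le_trans ?_ hS
  rw [← Set.ncard_coe_finset]
  refine Set.ncard_le_ncard_of_injOn (fun p => (p.1.val, p.2.val)) ?_ ?_ S.finite_toSet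
  · rintro p ⟨-, hp⟩
    have hp' : G.edist p w ≤ k := by rwa [edist_comm]
    have h1 := le_add_of_edist_le (f := fun p => p.1.val) (fun u v h => (hG u v h).1) hp
    have h2 := le_add_of_edist_le (f := fun p => p.2.val) (fun u v h => (hG u v h).2) hp
    have h3 := le_add_of_edist_le (f := fun p => p.1.val) (fun u v h => (hG u v h).1) hp'
    have h4 := le_add_of_edist_le (f := fun p => p.2.val) (fun u v h => (hG u v h).2) hp'
    simp only [S, Finset.coe_product, Finset.coe_Icc, Set.mem_prod, Set.mem_Icc]
    omega
  · rintro ⟨a, b⟩ - ⟨c, d⟩ - h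
    simp only [Prod.mk.injEq] at h
    exact Prod.ext (Fin.ext h.1) (Fin.ext h.2)

/-- A sequence that meets a set and its complement enters or leaves the set at some step. -/
theorem exists_consecutive_of_mixed {M : ℕ} {P : Fin M → Prop} {x y : Fin M} (hx : P x)
    (hy : ¬ P y) : ∃ a b : Fin M, (a.val + 1 = b.val ∨ b.val + 1 = a.val) ∧ P a ∧ ¬ P b := by
  by_contra! hcon
  have key : ∀ d : ℕ, ∀ a b : Fin M, (a.val + d = b.val ∨ b.val + d = a.val) → P a → P b := by
    intro d
    induction d with
    | zero =>
      intro a b h ha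
      obtain rfl : a = b := Fin.ext (by omega)
      exact ha
    | succ d ih =>
      intro a b h ha
      have hb := b.2
      have ha' := a.2
      rcases h with h | h
      · exact hcon ⟨b.val - 1, by omega⟩ b (.inl (by simp; omega)) (ih a _ (.inl (by simp; omega)) ha)
      · exact hcon ⟨b.val + 1, by omega⟩ b (.inr (by simp)) (ih a _ (.inr (by simp; omega)) ha)
  rcases le_total x.val y.val with h | h
  · exact hy (key (y.val - x.val) x y (.inl (by omega)) hx)
  · exact hy (key (x.val - y.val) x y (.inr (by omega)) hx)

/-- The point of the grid with coordinates `r * i` and `r * j`. -/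
def gridPoint {r n : ℕ} (hr : 1 ≤ r) (i j : Fin n) : Fin (r * n) × Fin (r * n) :=
  (⟨r * i.val, Nat.mul_lt_mul_of_pos_left i.2 hr⟩, ⟨r * j.val, Nat.mul_lt_mul_of_pos_left j.2 hr⟩)

theorem gridPoint_injective {r n : ℕ} (hr : 1 ≤ r) :
    Function.Injective fun x : Fin n × Fin n => gridPoint hr x.1 x.2 := by
  rintro ⟨i, j⟩ ⟨i', j'⟩ h
  simp only [gridPoint, Prod.mk.injEq, Fin.mk.injEq] at h
  exact Prod.ext (Fin.ext (Nat.eq_of_mul_eq_mul_left hr h.1))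
    (Fin.ext (Nat.eq_of_mul_eq_mul_left hr h.2))

/-- The boundary of a vertex set meets every line that is neither contained in the set nor disjoint
from it. -/
theorem ncard_mixed_le {r n : ℕ} (hr : 1 ≤ r) {A B : Set (Fin (r * n) × Fin (r * n))}
    (line : Fin n → Fin (r * n) → Fin (r * n) × Fin (r * n))
    (c : Fin (r * n) × Fin (r * n) → ℕ) (hc : ∀ j x, c (line j x) = r * j.val)
    (hB : ∀ j x y, (x.val + 1 = y.val ∨ y.val + 1 = x.val) → line j x ∈ A → line j y ∉ A →
      line j x ∈ B) :
    {j | ∃ x y, line j x ∈ A ∧ line j y ∉ A}.ncard ≤ B.ncard := by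
  have hinj : Function.Injective fun j : Fin n => r * j.val := fun i j h =>
    Fin.ext (Nat.eq_of_mul_eq_mul_left hr h)
  rw [← Set.ncard_image_of_injective _ hinj]
  refine le_trans (Set.ncard_le_ncard ?_ (Set.toFinite _)) (Set.ncard_image_le (f := c))
  -- The coordinate `c` recovers the line from any of its points, so distinct mixed lines yield
  -- distinct boundary points.
  rintro _ ⟨j, ⟨x, y, hx, hy⟩, rfl⟩
  obtain ⟨a, b, hab, ha, hb⟩ := exists_consecutive_of_mixed (P := fun x => line j x ∈ A) hx hy
  exact ⟨line j a, hB j a b hab ha hb, hc j a⟩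

/-- At most `b` columns and `b` rows are mixed. As `b < n`, some column and some row are not, and
every unmixed line crosses one of these two, so all unmixed lines lie on the same side of `A`.
Branch points on the other side lie in the product of mixed columns and mixed rows. -/
theorem ncard_grid_le {r n : ℕ} (hr : 1 ≤ r) {A : Set (Fin (r * n) × Fin (r * n))} {b : ℕ}
    (hA : {u ∈ A | ∃ w ∉ A, (subdividedGrid r (r * n)).Adj u w}.ncard ≤ b) (hb : b < n) :
    {x : Fin n × Fin n | gridPoint hr x.1 x.2 ∈ A}.ncard ≤ b * b ∨
      {x : Fin n × Fin n | gridPoint hr x.1 x.2 ∉ A}.ncard ≤ b * b := by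
  set B := {u ∈ A | ∃ w ∉ A, (subdividedGrid r (r * n)).Adj u w}
  let pt : Fin n → Fin (r * n) := fun i => ⟨r * i.val, Nat.mul_lt_mul_of_pos_left i.2 hr⟩
  let X : Set (Fin n) := {i | ∃ x y, (pt i, x) ∈ A ∧ (pt i, y) ∉ A}
  let Y : Set (Fin n) := {j | ∃ x y, (x, pt j) ∈ A ∧ (y, pt j) ∉ A}
  have hX : X.ncard ≤ b := (ncard_mixed_le hr (B := B) (fun i x => (pt i, x)) (fun p => p.1.val)
    (fun _ _ => rfl) fun i x y h hx hy =>
      ⟨hx, _, hy, .inr ⟨rfl, Dvd.intro _ rfl, h⟩⟩).trans hA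
  have hY : Y.ncard ≤ b := (ncard_mixed_le hr (B := B) (fun j x => (x, pt j)) (fun p => p.2.val)
    (fun _ _ => rfl) fun i x y h hx hy =>
      ⟨hx, _, hy, .inl ⟨rfl, Dvd.intro _ rfl, h⟩⟩).trans hA
  have hex : ∀ Z : Set (Fin n), Z.ncard ≤ b → ∃ i, i ∉ Z := by
    intro Z hZ
    by_contra! hall
    rw [Set.eq_univ_of_forall hall, Set.ncard_univ, Nat.card_fin] at hZ
    omega
  have hXY : ∀ Z : Set (Fin n × Fin n), Z ⊆ X ×ˢ Y → Z.ncard ≤ b * b := fun Z hZ => by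
    refine (Set.ncard_le_ncard hZ (Set.toFinite _)).trans ?_
    rw [Set.ncard_prod]
    exact Nat.mul_le_mul hX hY
  obtain ⟨i, hi⟩ := hex X hX
  obtain ⟨j, hj⟩ := hex Y hY
  have hcol : ∀ i ∉ X, ∀ x y, (pt i, x) ∈ A → (pt i, y) ∈ A := fun i hi x y hx => by
    by_contra hy
    exact hi ⟨x, y, hx, hy⟩
  have hrow : ∀ j ∉ Y, ∀ x y, (x, pt j) ∈ A → (y, pt j) ∈ A := fun j hj x y hx => by
    by_contra hy
    exact hj ⟨x, y, hx, hy⟩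
  by_cases hij : (pt i, pt j) ∈ A
  · refine .inr (hXY _ ?_)
    rintro ⟨a, c⟩ hac
    constructor
    · by_contra ha
      exact hac (hcol a ha (pt j) (pt c) (hrow j hj (pt i) (pt a) hij))
    · by_contra hc
      exact hac (hrow c hc (pt i) (pt a) (hcol i hi (pt j) (pt c) hij))
  · refine .inl (hXY _ ?_)
    rintro ⟨a, c⟩ hac
    constructor
    · by_contra ha
      exact hij (hrow j hj (pt a) (pt i) (hcol a ha (pt c) (pt j) hac))
    · by_contra hc
      exact hij (hcol i hi (pt c) (pt j) (hrow c hc (pt a) (pt i) hac))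

theorem le_power {V : Type*} (G : SimpleGraph V) {k : ℕ} (hk : 1 ≤ k) : G ≤ G.power k :=
  fun u v h => ⟨h.ne, (edist_eq_one_iff_adj.2 h).le.trans (by exact_mod_cast hk)⟩

end SimpleGraph

/-- A class that contains graphs between subdivided grids and king's graphs of all sizes is not of
power-bounded clique-width. -/
theorem GraphClass.not_isPowerBoundedCliqueWidth {𝒢 : GraphClass} {r : ℕ} (hr : 1 ≤ r)
    (h : ∀ n : ℕ, ∃ G : SimpleGraph (Fin (r * n) × Fin (r * n)),
      SimpleGraph.subdividedGrid r (r * n) ≤ G ∧ G.IsKingLike ∧ 𝒢.Mem _ G) :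
    ¬ 𝒢.IsPowerBoundedCliqueWidth := by
  rintro ⟨k, hk, hbdd⟩
  obtain ⟨c, hc⟩ := ENat.ne_top_iff_exists.1 hbdd.ne
  set b := c * (2 * k + 1) ^ 2
  -- The grid has `9 * (b + 1) ^ 2` branch points; taking `m = 3 * (b + 1) ^ 2` leaves at least `m >
  -- b * b` of them on each side of `A`.
  set n := 3 * (b + 1)
  obtain ⟨G, hle, hking, hmem⟩ := h n
  have hcw : (G.power k).cliqueWidth ≤ c := by
    rw [hc]
    exact le_iSup_of_le _ (le_iSup_of_le inferInstance (le_iSup_of_le (G.power k)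
      (le_iSup_of_le ⟨_, inferInstance, G, hmem, ⟨SimpleGraph.Iso.refl⟩⟩ le_rfl)))
  let w : Fin n × Fin n → Fin (r * n) × Fin (r * n) := fun x => SimpleGraph.gridPoint hr x.1 x.2
  have hw : w.Injective := SimpleGraph.gridPoint_injective hr
  have hW : (Set.range w).ncard = n * n := by
    rw [← Set.image_univ, Set.ncard_image_of_injective _ hw, Set.ncard_univ]
    simp
  have hnn : n * n = 9 * ((b + 1) * (b + 1)) := by ring
  have hpos : 1 ≤ (b + 1) * (b + 1) := Nat.mul_pos (by omega) (by omega)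
  have hbb : b * b < (b + 1) * (b + 1) := Nat.mul_self_lt_mul_self (by omega)
  obtain ⟨A, h1, h2, h3⟩ := SimpleGraph.exists_balanced_of_cliqueWidth_le hcw
    (hking.ncard_neighborSet_power_le k) (Set.range w) (m := 3 * ((b + 1) * (b + 1)))
    (by omega) (by omega)
  have hin : {x | w x ∈ A}.ncard = (Set.range w ∩ A).ncard := by
    rw [← Set.ncard_image_of_injective _ hw]
    congr 1
    ext y
    constructor
    · rintro ⟨x, hx, rfl⟩
      exact ⟨⟨x, rfl⟩, hx⟩
    · rintro ⟨⟨x, rfl⟩, hx⟩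
      exact ⟨x, hx, rfl⟩
  have hout : {x | w x ∈ A}.ncard + {x | w x ∉ A}.ncard = n * n := by
    have : {x | w x ∈ A}.ncard + {x | w x ∉ A}.ncard = Nat.card (Fin n × Fin n) :=
      Set.ncard_add_ncard_compl _
    rw [this, Nat.card_prod, Nat.card_fin]
  have hbd : {u ∈ A | ∃ w ∉ A, (SimpleGraph.subdividedGrid r (r * n)).Adj u w}.ncard ≤ b := by
    refine (Set.ncard_le_ncard ?_ (Set.toFinite _)).trans h3
    rintro u ⟨hu, v, hv, hadj⟩
    exact ⟨hu, v, hv, G.le_power hk (hle hadj)⟩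
  have := SimpleGraph.ncard_grid_le hr hbd (by omega)
  change {x | w x ∈ A}.ncard ≤ b * b ∨ {x | w x ∉ A}.ncard ≤ b * b at this
  omega

/-! ### Graphs of large girth and claw-free graphs between subdivided grids and king's graphs -/

namespace SimpleGraph

/-- If every vertex has at most one neighbour of no larger rank among the vertices of a closed
walk, then the closed walk is not a cycle. -/
theorem Walk.IsCycle.false_of_rank {V : Type*} {G : SimpleGraph V} {v : V} {c : G.Walk v v}
    (hc : c.IsCycle) (h : V → ℕ)
    (hrank : ∀ w ∈ c.support, ∀ s ∈ c.support, ∀ t ∈ c.support, G.Adj w s → G.Adj w t →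
      h s ≤ h w → h t ≤ h w → s = t) : False := by
  classical
  -- At a vertex of maximal rank, both cycle neighbours have no larger rank, yet they are distinct.
  obtain ⟨w, hw, hmax⟩ := c.support.toFinset.exists_max_image h
    ⟨v, List.mem_toFinset.2 c.start_mem_support⟩
  rw [List.mem_toFinset] at hw
  have hc' := hc.rotate hw
  have hmem : ∀ x, x ∈ (c.rotate w hw).support → x ∈ c.support := fun x hx => by
    simpa using hx
  have hs := hmem _ ((c.rotate w hw).getVert_mem_support 1)
  have ht := hmem _ ((c.rotate w hw).getVert_mem_support ((c.rotate w hw).length - 1))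
  exact hc'.snd_ne_penultimate (hrank w hw _ hs _ ht ((c.rotate w hw).adj_snd hc'.not_nil)
    ((c.rotate w hw).adj_penultimate hc'.not_nil).symm
    (hmax _ (List.mem_toFinset.2 hs)) (hmax _ (List.mem_toFinset.2 ht)))

theorem IsKingLike.le_add_length {M : ℕ} {G : SimpleGraph (Fin M × Fin M)} (hG : G.IsKingLike)
    {p q : Fin M × Fin M} (c : G.Walk p q) :
    q.1.val ≤ p.1.val + c.length ∧ q.2.val ≤ p.2.val + c.length :=
  ⟨c.le_add_length (f := fun p => p.1.val) fun u v h => (hG u v h).1,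
    c.le_add_length (f := fun p => p.2.val) fun u v h => (hG u v h).2⟩

/-- Two multiples of `r` within a window of width `2 * l < r` coincide; with none present, the value
`0` is a harmless default. -/
theorem exists_unique_multiple {V : Type*} {r l x : ℕ} (hl : 2 * l < r) (S : Set V) (f : V → ℕ)
    (hS : ∀ q ∈ S, f q ≤ x + l ∧ x ≤ f q + l) : ∃ a, ∀ q ∈ S, r ∣ f q → f q = a := by
  by_cases hex : ∃ q ∈ S, r ∣ f q
  · obtain ⟨q, hq, hd⟩ := hex
    refine ⟨f q, fun p hp hdp => ?_⟩
    have h1 := hS q hq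
    have h2 := hS p hp
    have h3 := Nat.eq_zero_of_dvd_of_lt (Nat.dvd_sub hd hdp) (by omega)
    have h4 := Nat.eq_zero_of_dvd_of_lt (Nat.dvd_sub hdp hd) (by omega)
    omega
  · exact ⟨0, fun q hq hd => (hex ⟨q, hq, hd⟩).elim⟩

/-- Subdivided grids have large girth. -/
theorem not_isCycle_subdividedGrid {r M : ℕ} {v : Fin M × Fin M}
    {c : (subdividedGrid r M).Walk v v} (hl : 2 * c.length < r) : ¬ c.IsCycle := by
  classical
  intro hc
  have hwin : ∀ q ∈ c.support, (q.1.val ≤ v.1.val + c.length ∧ v.1.val ≤ q.1.val + c.length) ∧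
      (q.2.val ≤ v.2.val + c.length ∧ v.2.val ≤ q.2.val + c.length) := by
    intro q hq
    have h1 := (subdividedGrid_isKingLike r M).le_add_length (c.takeUntil q hq)
    have h2 := (subdividedGrid_isKingLike r M).le_add_length (c.takeUntil q hq).reverse
    have h3 := c.length_takeUntil_le_length hq
    rw [Walk.length_reverse] at h2
    omega
  obtain ⟨a, ha⟩ := exists_unique_multiple hl {q | q ∈ c.support} (fun q => q.1.val)
    fun q hq => (hwin q hq).1
  obtain ⟨b, hb⟩ := exists_unique_multiple hl {q | q ∈ c.support} (fun q => q.2.val)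
    fun q hq => (hwin q hq).2
  -- The cycle sees at most one column `a` and one row `b` that carry edges. The rank is the taxicab
  -- distance to `(a, b)`, with absolute values written by truncated subtraction; only one step
  -- along these lines can approach that point.
  refine hc.false_of_rank
    (fun q => (q.1.val - a) + (a - q.1.val) + (q.2.val - b) + (b - q.2.val)) ?_
  rintro ⟨w1, w2⟩ hw ⟨s1, s2⟩ - ⟨t1, t2⟩ - hws hwt hs ht
  have ha' := ha _ hw
  have hb' := hb _ hw
  simp only at ha' hb' hs ht
  rw [Prod.mk.injEq, Fin.ext_iff, Fin.ext_iff]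
  rcases hws with ⟨h1, h2, h3⟩ | ⟨h1, h2, h3⟩ <;> rcases hwt with ⟨h4, h5, h6⟩ | ⟨h4, h5, h6⟩ <;>
    simp only [Fin.ext_iff] at h1 h2 h3 h4 h5 h6
  · have := hb' h2
    omega
  · have := hb' h2
    have := ha' h5
    omega
  · have := ha' h2
    have := hb' h5
    omega
  · have := ha' h2
    omega

/-- The points of a square grid, two being adjacent when they lie in a common block of the tiling
by two-by-two blocks or of its diagonal translate. -/
def blockGraph (M : ℕ) : SimpleGraph (Fin M × Fin M) where
  Adj p q := p ≠ q ∧ ((p.1.val / 2 = q.1.val / 2 ∧ p.2.val / 2 = q.2.val / 2) ∨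
    ((p.1.val + 1) / 2 = (q.1.val + 1) / 2 ∧ (p.2.val + 1) / 2 = (q.2.val + 1) / 2))
  symm := ⟨fun _ _ h => ⟨h.1.symm, h.2.imp (fun h => ⟨h.1.symm, h.2.symm⟩)
    fun h => ⟨h.1.symm, h.2.symm⟩⟩⟩
  loopless := ⟨fun _ h => h.1 rfl⟩

theorem blockGraph_isKingLike (M : ℕ) : (blockGraph M).IsKingLike := by
  rintro p q ⟨-, h⟩
  omega

/-- Consecutive integers agree after halving, either as they stand or after both are shifted by one,
according to parity. -/
theorem subdividedGrid_le_blockGraph (r M : ℕ) : subdividedGrid r M ≤ blockGraph M := by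
  rintro p q h
  refine ⟨h.ne, ?_⟩
  rcases h with ⟨h1, -, h3⟩ | ⟨h1, -, h3⟩
  · rw [h1]
    omega
  · rw [h1]
    omega

/-- Block graphs are claw-free. -/
theorem blockGraph_claw_free {M : ℕ} {p a b c : Fin M × Fin M} (ha : (blockGraph M).Adj p a)
    (hb : (blockGraph M).Adj p b) (hc : (blockGraph M).Adj p c) (hab : a ≠ b) (hac : a ≠ c)
    (hbc : b ≠ c) :
    (blockGraph M).Adj a b ∨ (blockGraph M).Adj a c ∨ (blockGraph M).Adj b c := by
  -- The point `p` lies in only two blocks, so two of its three neighbours share one.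
  rcases ha.2 with h1 | h1 <;> rcases hb.2 with h2 | h2 <;> rcases hc.2 with h3 | h3
  · exact .inl ⟨hab, .inl (by omega)⟩
  · exact .inl ⟨hab, .inl (by omega)⟩
  · exact .inr (.inl ⟨hac, .inl (by omega)⟩)
  · exact .inr (.inr ⟨hbc, .inr (by omega)⟩)
  · exact .inr (.inr ⟨hbc, .inl (by omega)⟩)
  · exact .inr (.inl ⟨hac, .inr (by omega)⟩)
  · exact .inl ⟨hab, .inr (by omega)⟩
  · exact .inl ⟨hab, .inr (by omega)⟩

/-! ### Graphs without cycles and claws -/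

theorem IsAcyclic.not_adj_of_adj_of_adj {V : Type*} {G : SimpleGraph V} (hG : G.IsAcyclic)
    {v a b : V} (ha : G.Adj v a) (hb : G.Adj v b) : ¬ G.Adj a b := by
  classical
  intro hab
  exact hG.cliqueFree le_rfl {v, a, b} (is3Clique_triple_iff.2 ⟨ha, hb, hab⟩)

/-- Adjacent vertices of a path in an acyclic graph are consecutive. -/
theorem IsAcyclic.eq_succ_of_adj_getVert {V : Type*} {G : SimpleGraph V} (hG : G.IsAcyclic)
    {u v : V} {p : G.Walk u v} (hp : p.IsPath) {i j : ℕ} (hij : i ≤ j) (hj : j ≤ p.length)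
    (hadj : G.Adj (p.getVert i) (p.getVert j)) : j = i + 1 := by
  -- The segment of `p` and the edge are two paths with the same ends, hence equal in an acyclic
  -- graph.
  have hq : ((p.drop i).take (j - i)).IsPath := (hp.drop i).take _
  have hend : (p.drop i).getVert (j - i) = p.getVert j := by
    rw [Walk.drop_getVert]
    congr 1
    omega
  have hadj' : G.Adj (p.getVert i) ((p.drop i).getVert (j - i)) := hend ▸ hadj
  have := congrArg (fun q : G.Path _ _ => q.1.length)
    ((hG.subsingleton_path _ _).elim ⟨_, hq⟩ (Path.singleton hadj'))
  simp only [Walk.take_length, Walk.drop_length, Path.singleton, Walk.length_cons,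
    Walk.length_nil] at this
  omega

/-- Each component of a finite graph contains a longest path. -/
theorem exists_longest_path {V : Type*} [Finite V] (G : SimpleGraph V)
    (C : G.ConnectedComponent) : ∃ (u v : V) (p : G.Walk u v), p.IsPath ∧
      G.connectedComponentMk u = C ∧ ∀ (u' v' : V) (q : G.Walk u' v'), q.IsPath →
        G.connectedComponentMk u' = C → q.length ≤ p.length := by
  classical
  have := Fintype.ofFinite V
  let P : ℕ → Prop := fun l => ∃ (u v : V) (p : G.Walk u v), p.IsPath ∧
    G.connectedComponentMk u = C ∧ p.length = l
  have hbdd : ∀ l, P l → l ≤ Fintype.card V := by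
    rintro l ⟨u, v, p, hp, -, rfl⟩
    exact hp.length_lt.le
  have h0 : P 0 := by
    obtain ⟨u, hu⟩ := C.exists_rep
    exact ⟨u, u, .nil, .nil, hu, rfl⟩
  obtain ⟨u, v, p, hp, hu, hl⟩ := Nat.findGreatest_spec (P := P) (Nat.zero_le (Fintype.card V)) h0
  refine ⟨u, v, p, hp, hu, fun u' v' q hq hu' => ?_⟩
  rw [hl]
  have hP : P q.length := ⟨u', v', q, hq, hu', rfl⟩
  exact Nat.le_findGreatest (hbdd _ hP) hP

/-- In a graph of maximum degree at most two, a longest path of a component is spanning. -/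
theorem mem_support_of_longest {V : Type*} {G : SimpleGraph V}
    (hdeg : ∀ v a b c, G.Adj v a → G.Adj v b → G.Adj v c → a = b ∨ a = c ∨ b = c)
    {u v : V} {p : G.Walk u v} (hp : p.IsPath)
    (hmax : ∀ (u' v' : V) (q : G.Walk u' v'), q.IsPath →
      G.connectedComponentMk u' = G.connectedComponentMk u → q.length ≤ p.length)
    {w : V} (hw : G.Reachable u w) : w ∈ p.support := by
  by_contra hnot
  obtain ⟨q⟩ := hw
  -- An edge leaving the path from an end would lengthen it; from an inner vertex it would give a
  -- third neighbour.
  obtain ⟨d, -, hd1, hd2⟩ := q.exists_boundary_dart {x | x ∈ p.support} p.start_mem_support hnot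
  have hadj := d.adj
  obtain ⟨i, hi, hil⟩ := Walk.mem_support_iff_exists_getVert.1 hd1
  change d.snd ∉ p.support at hd2
  rcases Nat.eq_zero_or_pos i with h0 | h0
  · subst h0
    rw [Walk.getVert_zero] at hi
    have hadj' : G.Adj d.snd u := hi ▸ hadj.symm
    have := hmax _ _ (Walk.cons hadj' p) (hp.cons hd2)
      (ConnectedComponent.eq.2 hadj'.reachable)
    rw [Walk.length_cons] at this
    omega
  · rcases eq_or_lt_of_le hil with hl | hl
    · rw [hl, Walk.getVert_length] at hi
      have hadj' : G.Adj v d.snd := hi ▸ hadj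
      have := hmax _ _ (p.concat hadj') (hp.concat hd2 hadj') rfl
      rw [Walk.length_concat] at this
      omega
    · have h1 : G.Adj d.fst (p.getVert (i + 1)) := hi ▸ p.adj_getVert_succ hl
      have h2 : G.Adj d.fst (p.getVert (i - 1)) := by
        have := p.adj_getVert_succ (i := i - 1) (by omega)
        rw [Nat.sub_add_cancel h0, hi] at this
        exact this.symm
      rcases hdeg _ _ _ _ h1 h2 hadj with h | h | h
      · have := hp.getVert_injOn (by simp; omega) (by simp; omega) h
        omega
      · exact hd2 (h ▸ p.getVert_mem_support _)
      · exact hd2 (h ▸ p.getVert_mem_support _)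

/-- A finite acyclic graph of maximum degree at most two is a disjoint union of paths. -/
theorem IsAcyclic.isDisjointUnionOfPaths {V : Type*} [Finite V] {G : SimpleGraph V}
    (hG : G.IsAcyclic)
    (hdeg : ∀ v a b c, G.Adj v a → G.Adj v b → G.Adj v c → a = b ∨ a = c ∨ b = c) :
    G.IsDisjointUnionOfPaths := by
  choose s t p hp hs hmax using G.exists_longest_path
  have hfin : Finite G.ConnectedComponent := Quot.finite _
  obtain ⟨m, ⟨σ⟩⟩ := Finite.exists_equiv_fin G.ConnectedComponent
  have hcomp : ∀ C i, G.connectedComponentMk ((p C).getVert i) = C := fun C i => by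
    refine (ConnectedComponent.eq.2 ?_).trans (hs C)
    exact ((p C).take i).reachable.symm
  have hsupp : ∀ w, w ∈ (p (G.connectedComponentMk w)).support := fun w =>
    mem_support_of_longest hdeg (hp _)
      (fun u' v' q hq hu => hmax _ u' v' q hq (hu.trans (hs _))) (ConnectedComponent.eq.1 (hs _))
  let f : (Σ i : Fin m, Fin ((p (σ.symm i)).length + 1)) → V :=
    fun x => (p (σ.symm x.1)).getVert x.2
  have hf : ∀ i j, G.connectedComponentMk (f ⟨i, j⟩) = σ.symm i := fun i j => hcomp _ _
  have hbij : f.Bijective := by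
    constructor
    · rintro ⟨i, a⟩ ⟨j, b⟩ h
      obtain rfl : i = j := σ.symm.injective (by rw [← hf i a, h, hf j b])
      have ha := a.2
      have hb := b.2
      have := (hp _).getVert_injOn (by simp; omega) (by simp; omega) h
      obtain rfl : a = b := Fin.ext this
      rfl
    · intro w
      obtain ⟨i, hi, hil⟩ := Walk.mem_support_iff_exists_getVert.1 (hsupp w)
      obtain ⟨j, hj⟩ := σ.symm.surjective (G.connectedComponentMk w)
      rw [← hj] at hi hil
      exact ⟨⟨j, ⟨i, Nat.lt_succ_of_le hil⟩⟩, hi⟩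
  refine ⟨m, fun i => (p (σ.symm i)).length + 1, fun _ => Nat.le_add_left 1 _, ⟨RelIso.symm
    ⟨Equiv.ofBijective f hbij, ?_⟩⟩⟩
  rintro ⟨i, a⟩ ⟨j, b⟩
  change G.Adj (f ⟨i, a⟩) (f ⟨j, b⟩) ↔ _
  have ha : a.val < (p (σ.symm i)).length + 1 := a.2
  have hb : b.val < (p (σ.symm j)).length + 1 := b.2
  constructor
  · intro hadj
    obtain rfl : i = j := σ.symm.injective (by
      rw [← hf i a, ← hf j b]
      exact ConnectedComponent.eq.2 hadj.reachable)
    rw [disjointUnion_adj_mk, pathGraph_adj]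
    rcases le_total a.val b.val with h | h
    · exact .inl (hG.eq_succ_of_adj_getVert (hp _) h (Nat.le_of_lt_succ hb) hadj).symm
    · exact .inr (hG.eq_succ_of_adj_getVert (hp _) h (Nat.le_of_lt_succ ha) hadj.symm).symm
  · intro hadj
    obtain rfl : i = j := disjointUnion_adj_fst hadj
    rw [disjointUnion_adj_mk, pathGraph_adj] at hadj
    change G.Adj ((p (σ.symm i)).getVert a) ((p (σ.symm i)).getVert b)
    rcases hadj with h | h
    · rw [← h]
      exact (p _).adj_getVert_succ (by omega)
    · rw [← h]
      exact ((p _).adj_getVert_succ (by omega)).symm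

end SimpleGraph

theorem mainTheorem2 {U : Type*} [Finite U] (H : SimpleGraph U) :
    (GraphClass.free H).IsPowerBoundedCliqueWidth ↔ H.IsDisjointUnionOfPaths := by
  refine ⟨fun hpow => ?_, GraphClass.isPowerBoundedCliqueWidth_free⟩
  have hacyc : H.IsAcyclic := by
    intro v c hc
    -- This `r` is just large enough to exclude cycles of length `c.length`.
    refine GraphClass.not_isPowerBoundedCliqueWidth (r := 2 * c.length + 1) (by omega)
      (fun n => ⟨SimpleGraph.subdividedGrid _ _, le_rfl,
        SimpleGraph.subdividedGrid_isKingLike _ _, ?_⟩) hpow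
    rintro ⟨f⟩
    refine SimpleGraph.not_isCycle_subdividedGrid (c := c.map f.toHom) ?_ (hc.map f.injective)
    rw [SimpleGraph.Walk.length_map]
    omega
  refine hacyc.isDisjointUnionOfPaths fun v a b c ha hb hc => ?_
  by_contra! hne
  -- For `r = 1` every line carries edges, giving the full grid. By acyclicity, three distinct
  -- neighbours of `v` form an induced claw.
  refine GraphClass.not_isPowerBoundedCliqueWidth (r := 1) le_rfl
    (fun n => ⟨SimpleGraph.blockGraph _, SimpleGraph.subdividedGrid_le_blockGraph _ _,
      SimpleGraph.blockGraph_isKingLike _, ?_⟩) hpow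
  rintro ⟨f⟩
  rcases SimpleGraph.blockGraph_claw_free (f.map_adj_iff.2 ha) (f.map_adj_iff.2 hb)
    (f.map_adj_iff.2 hc) (f.injective.ne hne.1) (f.injective.ne hne.2.1)
    (f.injective.ne hne.2.2) with h | h | h
  · exact hacyc.not_adj_of_adj_of_adj ha hb (f.map_adj_iff.1 h)
  · exact hacyc.not_adj_of_adj_of_adj ha hc (f.map_adj_iff.1 h)
  · exact hacyc.not_adj_of_adj_of_adj hb hc (f.map_adj_iff.1 h)
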